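/- Let $\Omega\subset\mathbb{R}^N$ be a bounded domain (a nonempty bounded connected open set), let $a\in C(\overline\Omega)\cap L^\infty(\Omega)$, and let $K:\Omega\times\Omega\to[0,\infty)$ be such that $K(x,\cdot)$ is measurable for every $x\in\Omega$ and $K(\cdot,y)$ is uniformly continuous on $\Omega$ for almost every $y\in\Omega$. Assume moreover that there are constants $r_0\ge r_1>0$ and $C_0\ge c_0>0$ such that $$C_0\,\mathbf 1_{\Omega\cap B_{r_0}(x)}(y)\ \ge\ K(x,y)\ \ge\ c_0\,\mathbf 1_{\Omega\cap B_{r_1}(x)}(y)\qquad\text{for all }x,y\in\Omega .$$ Put $L_\Omega[\varphi](x):=\int_\Omega K(x,y)\varphi(y)\,dy$ and define $$\lambda_p(L_\Omega+a):=\sup\{\lambda\in\mathbb{R} : \exists\,\varphi\in C(\overline\Omega),\ \varphi>0\text{ on }\overline\Omega,\ L_\Omega[\varphi]+a\varphi+\lambda\varphi\le 0\text{ in }\Omega\},$$ $$\lambda_p'(L_\Omega+a):=\inf\{\lambda\in\mathbb{R} : \exists\,\varphi\in C(\Omega)\cap L^\infty(\Omega),\ \varphi\ge 0,\ \varphi\not\equiv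 0,\ L_\Omega[\varphi]+(a+\lambda)\varphi\ge 0\text{ in }\Omega\},$$ $$\lambda_p''(L_\Omega+a):=\inf\{\lambda\in\mathbb{R} : \exists\,\varphi\in C_c(\Omega),\ \varphi\ge 0,\ \varphi\not\equiv 0,\ L_\Omega[\varphi]+(a+\lambda)\varphi\ge 0\text{ in }\Omega\}.$$ Then these three quantities are finite and $$\lambda_p(L_\Omega+a)=\lambda_p'(L_\Omega+a)=\lambda_p''(L_\Omega+a).$$ If in addition $K$ is symmetric, that is, $K(x,y)=K(y,x)$ for all $x,y\in\Omega$, then they are also equal to $$\lambda_v(L_\Omega+a):=\inf_{\varphi\in L^2(\Omega),\ \varphi\not\equiv 0}\ -\frac{\langle L_\Omega[\varphi]+a\varphi,\varphi\rangle_{L^2(\Omega)}}{\|\varphi\|_{L^2(\Omega)}^2}.$$ -/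

import Mathlib

open MeasureTheory

noncomputable section

namespace NonlocalEigenvalue

variable {N : ℕ}

/-- The nonlocal operator `L_Ω[φ](x) = ∫_Ω K(x,y) φ(y) dy`. -/
def nonlocalOp (Ω : Set (EuclideanSpace ℝ (Fin N)))
    (K : EuclideanSpace ℝ (Fin N) → EuclideanSpace ℝ (Fin N) → ℝ)
    (φ : EuclideanSpace ℝ (Fin N) → ℝ) (x : EuclideanSpace ℝ (Fin N)) : ℝ :=
  ∫ y in Ω, K x y * φ y

/-- `a ∈ C(closure Ω) ∩ L^∞(Ω)`. -/
structure IsPotential (Ω : Set (EuclideanSpace ℝ (Fin N)))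
    (a : EuclideanSpace ℝ (Fin N) → ℝ) : Prop where
  continuousOn : ContinuousOn a (closure Ω)
  memLp : MemLp a ⊤ (volume.restrict Ω)

/-- `K` is a nonnegative Caratheodory function on `Ω × Ω`: `K(x,·)` is (Lebesgue) measurable on `Ω`
for every `x ∈ Ω`, and `K(·,y)` is uniformly continuous on `Ω` for almost every `y ∈ Ω`. -/
structure IsCaratheodoryKernel (Ω : Set (EuclideanSpace ℝ (Fin N)))
    (K : EuclideanSpace ℝ (Fin N) → EuclideanSpace ℝ (Fin N) → ℝ) : Prop where
  nonneg : ∀ x ∈ Ω, ∀ y ∈ Ω, 0 ≤ K x y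
  measurable : ∀ x ∈ Ω, AEMeasurable (K x) (volume.restrict Ω)
  uniformContinuous : ∀ᵐ y ∂(volume.restrict Ω), UniformContinuousOn (fun x => K x y) Ω

/-- The nondegeneracy condition
`C₀ 1_{Ω ∩ B_{r₀}(x)}(y) ≥ K(x,y) ≥ c₀ 1_{Ω ∩ B_{r₁}(x)}(y)` for all `x, y ∈ Ω`. -/
def IsNondegenerate (Ω : Set (EuclideanSpace ℝ (Fin N)))
    (K : EuclideanSpace ℝ (Fin N) → EuclideanSpace ℝ (Fin N) → ℝ) : Prop :=
  ∃ r₀ r₁ C₀ c₀ : ℝ, 0 < r₁ ∧ r₁ ≤ r₀ ∧ 0 < c₀ ∧ c₀ ≤ C₀ ∧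
    ∀ x ∈ Ω, ∀ y ∈ Ω,
      K x y ≤ C₀ * (Ω ∩ Metric.ball x r₀).indicator (fun _ => (1 : ℝ)) y ∧
      c₀ * (Ω ∩ Metric.ball x r₁).indicator (fun _ => (1 : ℝ)) y ≤ K x y

/-- `λ_p(L_Ω + a)`: the supremum, in the extended reals, of all real `l` for which there is
`φ ∈ C(closure Ω)`, `φ > 0`, with `L_Ω[φ] + a φ + l φ ≤ 0` in `Ω`. -/
def lambdaP (Ω : Set (EuclideanSpace ℝ (Fin N)))
    (K : EuclideanSpace ℝ (Fin N) → EuclideanSpace ℝ (Fin N) → ℝ)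
    (a : EuclideanSpace ℝ (Fin N) → ℝ) : EReal :=
  sSup ((fun l : ℝ => (l : EReal)) '' {l : ℝ | ∃ φ : EuclideanSpace ℝ (Fin N) → ℝ,
    ContinuousOn φ (closure Ω) ∧ (∀ x ∈ closure Ω, 0 < φ x) ∧
    ∀ x ∈ Ω, nonlocalOp Ω K φ x + a x * φ x + l * φ x ≤ 0})

/-- `λ_p'(L_Ω + a)`: the infimum, in the extended reals, of all real `l` for which there is
`φ ∈ C(Ω) ∩ L^∞(Ω)`, `φ ≥ 0`, `φ ≢ 0`, with `L_Ω[φ] + (a + l) φ ≥ 0` in `Ω`. -/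
def lambdaP' (Ω : Set (EuclideanSpace ℝ (Fin N)))
    (K : EuclideanSpace ℝ (Fin N) → EuclideanSpace ℝ (Fin N) → ℝ)
    (a : EuclideanSpace ℝ (Fin N) → ℝ) : EReal :=
  sInf ((fun l : ℝ => (l : EReal)) '' {l : ℝ | ∃ φ : EuclideanSpace ℝ (Fin N) → ℝ,
    ContinuousOn φ Ω ∧ MemLp φ ⊤ (volume.restrict Ω) ∧
    (∀ x ∈ Ω, 0 ≤ φ x) ∧ (∃ x ∈ Ω, φ x ≠ 0) ∧
    ∀ x ∈ Ω, 0 ≤ nonlocalOp Ω K φ x + (a x + l) * φ x})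

/-- `λ_p''(L_Ω + a)`: the infimum, in the extended reals, of all real `l` for which there is
`φ ∈ C_c(Ω)`, `φ ≥ 0`, `φ ≢ 0`, with `L_Ω[φ] + (a + l) φ ≥ 0` in `Ω`. -/
def lambdaP'' (Ω : Set (EuclideanSpace ℝ (Fin N)))
    (K : EuclideanSpace ℝ (Fin N) → EuclideanSpace ℝ (Fin N) → ℝ)
    (a : EuclideanSpace ℝ (Fin N) → ℝ) : EReal :=
  sInf ((fun l : ℝ => (l : EReal)) '' {l : ℝ | ∃ φ : EuclideanSpace ℝ (Fin N) → ℝ,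
    Continuous φ ∧ HasCompactSupport φ ∧ tsupport φ ⊆ Ω ∧
    (∀ x ∈ Ω, 0 ≤ φ x) ∧ (∃ x ∈ Ω, φ x ≠ 0) ∧
    ∀ x ∈ Ω, 0 ≤ nonlocalOp Ω K φ x + (a x + l) * φ x})

/-- `λ_v(L_Ω + a)`: the infimum, in the extended reals, of the Rayleigh quotients
`- ⟨L_Ω[φ] + a φ, φ⟩ / ‖φ‖²` over all `φ ∈ L²(Ω)`, `φ ≢ 0`, with the scalar product and the norm
of `L²(Ω)`. -/
def lambdaV (Ω : Set (EuclideanSpace ℝ (Fin N)))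
    (K : EuclideanSpace ℝ (Fin N) → EuclideanSpace ℝ (Fin N) → ℝ)
    (a : EuclideanSpace ℝ (Fin N) → ℝ) : EReal :=
  sInf ((fun l : ℝ => (l : EReal)) '' {l : ℝ | ∃ φ : EuclideanSpace ℝ (Fin N) → ℝ,
    MemLp φ 2 (volume.restrict Ω) ∧ ¬ (φ =ᵐ[volume.restrict Ω] 0) ∧
    l = -((∫ x in Ω, (nonlocalOp Ω K φ x + a x * φ x) * φ x) / ∫ x in Ω, φ x ^ 2)})

end NonlocalEigenvalue

end

/-!
The inequality `λ_p ≤ λ_p'` is a sliding argument (`supersolution_le_subsolution`), and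
`λ_p' ≤ λ_p''` holds because compactly supported test functions are admissible for `λ_p'`. What
remains is `λ_p'' ≤ λ_p =: Λ`, although `L_Ω + a` need not have a principal eigenfunction.

If `Λ ≥ -sup a`, a bump function supported where `a` is close to its supremum is a subsolution at
a level close to `Λ`. If `Λ < -sup a`, then for small `η > 0` the equation
`L_Ω[u] + (a + Λ - η) u = -1` has a positive solution, obtained by monotone iteration below a
supersolution (`exists_solution_of_lt`). It must be large, of order `1 / η`, at some point:
otherwise it would itself be a supersolution at the level `Λ + η`. Since
`L_Ω[u](x) ≥ c₀ ∫_{Ω ∩ B_{r₁}(x)} u`, a chain of balls in the connected set `Ω` gives a Harnack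
inequality `u ≥ c ∫_Ω u` (`exists_harnack_const`), so that `u` is of order at least `1 / η`
everywhere, with constants independent of `η`. Hence the right hand side `-1` is negligible
against `u`, and `u`, cut off close to the boundary, is a compactly supported subsolution at a
level `Λ + O(η)` (`exists_compactSubsolutionLevel_lt`). Neither compactness of `L_Ω` nor the
Krein-Rutman theorem enters.

For symmetric `K`, a supersolution `φ` at level `l` bounds the quadratic form of `L_Ω + a` by
`-l ‖ψ‖²` through the pointwise inequality `2 ψ(x) ψ(y) ≤ ψ(x)² φ(y) / φ(x) + ψ(y)² φ(x) / φ(y)`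
(`quadraticForm_le_of_mem_supersolutionLevels`), so `λ_p ≤ λ_v`; testing the Rayleigh quotient
with compactly supported subsolutions gives `λ_v ≤ λ_p''`. Fubini's theorem needs the joint
measurability of `K`, which is `aestronglyMeasurable_uncurry_kernel`.
-/

namespace NonlocalEigenvalue

open Set Filter Topology Metric

variable {N : ℕ} {Ω : Set (EuclideanSpace ℝ (Fin N))}
  {K : EuclideanSpace ℝ (Fin N) → EuclideanSpace ℝ (Fin N) → ℝ}
  {a : EuclideanSpace ℝ (Fin N) → ℝ} {C : ℝ}

/-! ### The integral operator -/

theorem norm_kernel_le (hK : IsCaratheodoryKernel Ω K) (hC : ∀ x ∈ Ω, ∀ y ∈ Ω, K x y ≤ C)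
    {x y : EuclideanSpace ℝ (Fin N)} (hx : x ∈ Ω) (hy : y ∈ Ω) : ‖K x y‖ ≤ C := by
  rw [Real.norm_of_nonneg (hK.nonneg x hx y hy)]
  exact hC x hx y hy

theorem integrableOn_kernel_mul (hΩ : MeasurableSet Ω) (hK : IsCaratheodoryKernel Ω K)
    (hC : ∀ x ∈ Ω, ∀ y ∈ Ω, K x y ≤ C) {u : EuclideanSpace ℝ (Fin N) → ℝ}
    (hu : IntegrableOn u Ω) {x : EuclideanSpace ℝ (Fin N)} (hx : x ∈ Ω) :
    IntegrableOn (fun y => K x y * u y) Ω :=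
  Integrable.bdd_mul (c := C) hu (hK.measurable x hx).aestronglyMeasurable
    ((ae_restrict_mem hΩ).mono fun _ hy => norm_kernel_le hK hC hx hy)

theorem nonlocalOp_mono (hΩ : MeasurableSet Ω) (hK : IsCaratheodoryKernel Ω K)
    (hC : ∀ x ∈ Ω, ∀ y ∈ Ω, K x y ≤ C) {u v : EuclideanSpace ℝ (Fin N) → ℝ}
    (hu : IntegrableOn u Ω) (hv : IntegrableOn v Ω) (h : ∀ y ∈ Ω, u y ≤ v y)
    {x : EuclideanSpace ℝ (Fin N)} (hx : x ∈ Ω) : nonlocalOp Ω K u x ≤ nonlocalOp Ω K v x :=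
  setIntegral_mono_on (integrableOn_kernel_mul hΩ hK hC hu hx)
    (integrableOn_kernel_mul hΩ hK hC hv hx) hΩ
    fun y hy => mul_le_mul_of_nonneg_left (h y hy) (hK.nonneg x hx y hy)

theorem nonlocalOp_nonneg (hΩ : MeasurableSet Ω) (hK : IsCaratheodoryKernel Ω K)
    {u : EuclideanSpace ℝ (Fin N) → ℝ} (h : ∀ y ∈ Ω, 0 ≤ u y)
    {x : EuclideanSpace ℝ (Fin N)} (hx : x ∈ Ω) : 0 ≤ nonlocalOp Ω K u x :=
  setIntegral_nonneg hΩ fun y hy => mul_nonneg (hK.nonneg x hx y hy) (h y hy)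

theorem nonlocalOp_congr (hΩ : MeasurableSet Ω) {u v : EuclideanSpace ℝ (Fin N) → ℝ}
    (h : EqOn u v Ω) (x : EuclideanSpace ℝ (Fin N)) : nonlocalOp Ω K u x = nonlocalOp Ω K v x :=
  setIntegral_congr_fun hΩ fun y hy => by simp only [h hy]

theorem nonlocalOp_const_mul (u : EuclideanSpace ℝ (Fin N) → ℝ) (c : ℝ)
    (x : EuclideanSpace ℝ (Fin N)) :
    nonlocalOp Ω K (fun y => c * u y) x = c * nonlocalOp Ω K u x := by
  unfold nonlocalOp
  rw [← integral_const_mul]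
  congr 1 with y
  ring

theorem nonlocalOp_sub (hΩ : MeasurableSet Ω) (hK : IsCaratheodoryKernel Ω K)
    (hC : ∀ x ∈ Ω, ∀ y ∈ Ω, K x y ≤ C) {u v : EuclideanSpace ℝ (Fin N) → ℝ}
    (hu : IntegrableOn u Ω) (hv : IntegrableOn v Ω)
    {x : EuclideanSpace ℝ (Fin N)} (hx : x ∈ Ω) :
    nonlocalOp Ω K (fun y => u y - v y) x = nonlocalOp Ω K u x - nonlocalOp Ω K v x := by
  unfold nonlocalOp
  rw [← integral_sub (integrableOn_kernel_mul hΩ hK hC hu hx)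
    (integrableOn_kernel_mul hΩ hK hC hv hx)]
  congr 1 with y
  ring

theorem nonlocalOp_le (hΩ : MeasurableSet Ω) (hK : IsCaratheodoryKernel Ω K)
    (hC : ∀ x ∈ Ω, ∀ y ∈ Ω, K x y ≤ C) {u : EuclideanSpace ℝ (Fin N) → ℝ}
    (hu : IntegrableOn u Ω) (h : ∀ y ∈ Ω, 0 ≤ u y)
    {x : EuclideanSpace ℝ (Fin N)} (hx : x ∈ Ω) : nonlocalOp Ω K u x ≤ C * ∫ y in Ω, u y := by
  rw [← integral_const_mul]
  exact setIntegral_mono_on (integrableOn_kernel_mul hΩ hK hC hu hx) (hu.const_mul C) hΩ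
    fun y hy => mul_le_mul_of_nonneg_right (hC x hx y hy) (h y hy)

/-- The moduli of continuity of `K(·, y)` may depend on `y`; dominated convergence along the
filter of pairs of nearby points still yields a uniform one for `L_Ω[u]`. -/
theorem uniformContinuousOn_nonlocalOp (hΩ : MeasurableSet Ω) (hK : IsCaratheodoryKernel Ω K)
    (hC : ∀ x ∈ Ω, ∀ y ∈ Ω, K x y ≤ C) {u : EuclideanSpace ℝ (Fin N) → ℝ}
    (hu : IntegrableOn u Ω) : UniformContinuousOn (nonlocalOp Ω K u) Ω := by
  have hmem : ∀ᶠ p in uniformity (EuclideanSpace ℝ (Fin N)) ⊓ 𝓟 (Ω ×ˢ Ω), p ∈ Ω ×ˢ Ω :=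
    mem_inf_of_right (mem_principal_self _)
  have key : Tendsto
      (fun p : EuclideanSpace ℝ (Fin N) × EuclideanSpace ℝ (Fin N) =>
        ∫ y in Ω, (K p.1 y - K p.2 y) * u y)
      (uniformity (EuclideanSpace ℝ (Fin N)) ⊓ 𝓟 (Ω ×ˢ Ω))
      (𝓝 (∫ _ in Ω, (0 : ℝ))) := by
    refine tendsto_integral_filter_of_dominated_convergence (fun y => (C + C) * ‖u y‖) ?_ ?_
      (hu.norm.const_mul _) ?_
    · filter_upwards [hmem] with p hp
      exact ((hK.measurable p.1 hp.1).sub (hK.measurable p.2 hp.2)).aestronglyMeasurable.mul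
        hu.aestronglyMeasurable
    · filter_upwards [hmem] with p hp
      filter_upwards [ae_restrict_mem hΩ] with y hy
      rw [norm_mul]
      gcongr
      exact (norm_sub_le _ _).trans
        (add_le_add (norm_kernel_le hK hC hp.1 hy) (norm_kernel_le hK hC hp.2 hy))
    · filter_upwards [hK.uniformContinuous] with y hy
      have h1 : Tendsto
          (fun p : EuclideanSpace ℝ (Fin N) × EuclideanSpace ℝ (Fin N) => K p.1 y - K p.2 y)
          (uniformity (EuclideanSpace ℝ (Fin N)) ⊓ 𝓟 (Ω ×ˢ Ω)) (𝓝 0) := by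
        rw [tendsto_zero_iff_norm_tendsto_zero]
        simpa only [Real.dist_eq, Real.norm_eq_abs] using tendsto_uniformity_iff_dist_tendsto_zero.1 hy
      simpa using h1.mul_const (u y)
  refine tendsto_uniformity_iff_dist_tendsto_zero.2 ?_
  rw [integral_zero] at key
  refine (tendsto_zero_iff_norm_tendsto_zero.1 key).congr' ?_
  filter_upwards [hmem] with p hp
  rw [Real.dist_eq, Real.norm_eq_abs]
  unfold nonlocalOp
  rw [← integral_sub (integrableOn_kernel_mul hΩ hK hC hu hp.1)
    (integrableOn_kernel_mul hΩ hK hC hu hp.2)]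
  simp only [sub_mul]

theorem exists_continuousOn_closure_of_uniformContinuousOn {X : Type*} [UniformSpace X]
    {s : Set X} {f : X → ℝ} (hf : UniformContinuousOn f s) :
    ∃ g : X → ℝ, ContinuousOn g (closure s) ∧ EqOn g f s := by
  refine ⟨extendFrom s f, continuousOn_extendFrom Subset.rfl fun x hx => ?_,
    extendFrom_extends hf.continuousOn⟩
  have hne : (𝓝[s] x).NeBot := mem_closure_iff_nhdsWithin_neBot.1 hx
  refine CompleteSpace.complete (f := map f (𝓝[s] x)) ⟨hne.map f, ?_⟩
  rw [prod_map_map_eq]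
  refine (map_mono ?_).trans hf
  refine le_inf ?_ (le_principal_iff.2 (prod_mem_prod self_mem_nhdsWithin self_mem_nhdsWithin))
  exact (Filter.prod_mono nhdsWithin_le_nhds nhdsWithin_le_nhds).trans
    (cauchy_nhds (a := x)).2

/-! ### A Harnack inequality for averages over balls -/

/-- On a bounded domain, a nonnegative function that dominates a fixed multiple of its integral
over the ball of radius `r` around each point dominates a fixed multiple of its total integral. -/
theorem exists_harnack_const (hΩ_open : IsOpen Ω) (hΩ_conn : IsPreconnected Ω)
    (hΩ_bdd : Bornology.IsBounded Ω) {r κ : ℝ} (hr : 0 < r) (hκ : 0 < κ) :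
    ∃ c > 0, ∀ u : EuclideanSpace ℝ (Fin N) → ℝ, IntegrableOn u Ω → (∀ x ∈ Ω, 0 ≤ u x) →
      (∀ x ∈ Ω, κ * ∫ y in Ω ∩ ball x r, u y ≤ u x) →
      ∀ x ∈ Ω, c * ∫ y in Ω, u y ≤ u x := by
  have hΩ : MeasurableSet Ω := hΩ_open.measurableSet
  have hmeas : ∀ x : EuclideanSpace ℝ (Fin N), ∀ s, MeasurableSet (Ω ∩ ball x s) :=
    fun x s => hΩ.inter measurableSet_ball
  have hfin : ∀ x : EuclideanSpace ℝ (Fin N), ∀ s, volume (Ω ∩ ball x s) < ⊤ := fun x s =>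
    (measure_mono inter_subset_right).trans_lt measure_ball_lt_top
  let P : EuclideanSpace ℝ (Fin N) → EuclideanSpace ℝ (Fin N) → Prop := fun x y =>
    ∃ c > 0, ∀ u : EuclideanSpace ℝ (Fin N) → ℝ, IntegrableOn u Ω → (∀ x ∈ Ω, 0 ≤ u x) →
      (∀ x ∈ Ω, κ * ∫ y in Ω ∩ ball x r, u y ≤ u x) →
      c * ∫ z in Ω ∩ ball x (r / 4), u z ≤ ∫ z in Ω ∩ ball y (r / 4), u z
  -- the balls of radius `r / 4` around nearby points are covered by balls of radius `r`
  have hsub : ∀ x y w : EuclideanSpace ℝ (Fin N), dist x y < r / 4 → w ∈ ball y (r / 4) →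
      Ω ∩ ball x (r / 4) ⊆ Ω ∩ ball w r := by
    intro x y w hxy hw z hz
    refine ⟨hz.1, ?_⟩
    have h1 := mem_ball.1 hz.2
    have h2 := mem_ball.1 hw
    have h3 := dist_triangle4 z x y w
    rw [dist_comm y w] at h3
    exact mem_ball.2 (by linarith)
  have hbound : ∀ x y w : EuclideanSpace ℝ (Fin N), dist x y < r / 4 → w ∈ Ω →
      w ∈ ball y (r / 4) →
      ∀ u : EuclideanSpace ℝ (Fin N) → ℝ, IntegrableOn u Ω → (∀ x ∈ Ω, 0 ≤ u x) →
      (∀ x ∈ Ω, κ * ∫ y in Ω ∩ ball x r, u y ≤ u x) →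
      κ * ∫ z in Ω ∩ ball x (r / 4), u z ≤ u w := by
    intro x y w hxy hwΩ hw u hu hu0 hur
    refine le_trans (mul_le_mul_of_nonneg_left ?_ hκ.le) (hur w hwΩ)
    refine setIntegral_mono_set (hu.mono_set inter_subset_left) ?_
      (Eventually.of_forall (hsub x y w hxy hw))
    exact (ae_restrict_mem (hmeas w r)).mono fun z hz => hu0 z hz.1
  have hlocal : ∀ x y, y ∈ Ω → dist x y < r / 4 → P x y := by
    intro x y hy hxy
    have hpos : 0 < volume.real (Ω ∩ ball y (r / 4)) := by
      refine ENNReal.toReal_pos (IsOpen.measure_pos _ (hΩ_open.inter isOpen_ball)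
        ⟨y, hy, mem_ball_self (by positivity)⟩).ne' (hfin _ _).ne
    refine ⟨κ * volume.real (Ω ∩ ball y (r / 4)), by positivity, fun u hu hu0 hur => ?_⟩
    calc κ * volume.real (Ω ∩ ball y (r / 4)) * ∫ z in Ω ∩ ball x (r / 4), u z
        = ∫ _ in Ω ∩ ball y (r / 4), κ * ∫ z in Ω ∩ ball x (r / 4), u z := by
          rw [setIntegral_const, smul_eq_mul]; ring
      _ ≤ ∫ z in Ω ∩ ball y (r / 4), u z := by
          refine setIntegral_mono_on (integrableOn_const (hfin _ _).ne)
            (hu.mono_set inter_subset_left) (hmeas _ _) fun w hw => ?_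
          exact hbound x y w hxy hw.1 hw.2 u hu hu0 hur
  have hall : ∀ x ∈ Ω, ∀ y ∈ Ω, P x y := by
    intro x hx y hy
    refine hΩ_conn.induction₂' P (fun x hx => ?_) ?_ hx hy
    · filter_upwards [self_mem_nhdsWithin,
        mem_nhdsWithin_of_mem_nhds (ball_mem_nhds x (show 0 < r / 4 by positivity))] with y hy hxy
      exact ⟨hlocal x y hy (mem_ball'.1 hxy), hlocal y x hx (mem_ball.1 hxy)⟩
    · rintro x y z - - - ⟨c, hc, h⟩ ⟨d, hd, h'⟩
      refine ⟨d * c, by positivity, fun u hu hu0 hur => ?_⟩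
      rw [mul_assoc]
      exact (mul_le_mul_of_nonneg_left (h u hu hu0 hur) hd.le).trans (h' u hu hu0 hur)
  rcases Ω.eq_empty_or_nonempty with rfl | ⟨x₀, hx₀⟩
  · exact ⟨1, one_pos, fun u _ _ _ x hx => absurd hx (notMem_empty x)⟩
  obtain ⟨t, htΩ, htfin, hcov⟩ := finite_approx_of_totallyBounded
    (isBounded_iff_subset_closedBall (0 : EuclideanSpace ℝ (Fin N)) |>.1 hΩ_bdd |>.elim
      fun R hR => (isCompact_closedBall _ R).totallyBounded.subset hR) (r / 4) (by positivity)
  choose! c hc hcP using fun z (hz : z ∈ Ω) => hall z hz x₀ hx₀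
  choose! d hd hdP using fun z (hz : z ∈ Ω) => hall x₀ hx₀ z hz
  have hev : ∀ᶠ e in 𝓝[>] (0 : ℝ), ∀ z ∈ t, e ≤ d z := by
    rw [eventually_all_finite htfin]
    intro z hz
    filter_upwards [Ioo_mem_nhdsGT (hd z (htΩ hz))] with e he using he.2.le
  obtain ⟨e, he, he0⟩ := (hev.and self_mem_nhdsWithin).exists
  replace he0 : 0 < e := he0
  set S := ∑ z ∈ htfin.toFinset, (c z)⁻¹ with hS
  have hS0 : 0 < S := by
    obtain ⟨z, hz⟩ := mem_iUnion₂.1 (hcov hx₀)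
    exact Finset.sum_pos (fun z hz => inv_pos.2 (hc z (htΩ (htfin.mem_toFinset.1 hz))))
      ⟨z, htfin.mem_toFinset.2 hz.1⟩
  refine ⟨κ * e * S⁻¹, by positivity, fun u hu hu0 hur x hx => ?_⟩
  set I := ∫ z in Ω ∩ ball x₀ (r / 4), u z with hI
  have hI0 : 0 ≤ I := setIntegral_nonneg (hmeas _ _) fun z hz => hu0 z hz.1
  have htotal : ∫ y in Ω, u y ≤ S * I := by
    calc ∫ y in Ω, u y
        ≤ ∫ y in Ω, ∑ z ∈ htfin.toFinset, (ball z (r / 4)).indicator u y := by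
          refine setIntegral_mono_on hu
            (integrable_finsetSum _ fun z _ => hu.indicator measurableSet_ball) hΩ fun y hy => ?_
          obtain ⟨z, hz, hyz⟩ := mem_iUnion₂.1 (hcov hy)
          refine le_trans (indicator_of_mem hyz u).ge
            (Finset.single_le_sum (f := fun z => (ball z (r / 4)).indicator u y) (fun w _ => ?_)
              (htfin.mem_toFinset.2 hz))
          exact indicator_apply_nonneg fun _ => hu0 y hy
      _ = ∑ z ∈ htfin.toFinset, ∫ y in Ω ∩ ball z (r / 4), u y := by
          rw [integral_finsetSum _ fun z _ => hu.indicator measurableSet_ball]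
          exact Finset.sum_congr rfl fun z _ => setIntegral_indicator measurableSet_ball
      _ ≤ ∑ z ∈ htfin.toFinset, (c z)⁻¹ * I := by
          refine Finset.sum_le_sum fun z hz => ?_
          have hzΩ := htΩ (htfin.mem_toFinset.1 hz)
          rw [← div_eq_inv_mul, le_div_iff₀' (hc z hzΩ)]
          exact hcP z hzΩ u hu hu0 hur
      _ = S * I := by rw [hS, Finset.sum_mul]
  obtain ⟨z, hz, hxz⟩ := mem_iUnion₂.1 (hcov hx)
  calc κ * e * S⁻¹ * ∫ y in Ω, u y ≤ κ * e * S⁻¹ * (S * I) := by gcongr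
    _ = κ * (e * I) := by field_simp
    _ ≤ κ * ∫ y in Ω ∩ ball z (r / 4), u y := by
        gcongr
        exact (mul_le_mul_of_nonneg_right (he z hz) hI0).trans
          (hdP z (htΩ hz) u hu hu0 hur)
    _ ≤ u x := hbound z z x (by simpa using hr) hx hxz u hu hu0 hur

/-! ### Sub- and supersolutions -/

/-- The real numbers `l` whose supremum is `λ_p`: those for which `L_Ω + a + l` has a continuous
supersolution that is positive on `closure Ω`. -/
def supersolutionLevels (Ω : Set (EuclideanSpace ℝ (Fin N)))
    (K : EuclideanSpace ℝ (Fin N) → EuclideanSpace ℝ (Fin N) → ℝ)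
    (a : EuclideanSpace ℝ (Fin N) → ℝ) : Set ℝ :=
  {l : ℝ | ∃ φ : EuclideanSpace ℝ (Fin N) → ℝ,
    ContinuousOn φ (closure Ω) ∧ (∀ x ∈ closure Ω, 0 < φ x) ∧
    ∀ x ∈ Ω, nonlocalOp Ω K φ x + a x * φ x + l * φ x ≤ 0}

/-- The real numbers `l` whose infimum is `λ_p'`: those for which `L_Ω + a + l` has a nontrivial
nonnegative subsolution that is bounded and continuous in `Ω`. -/
def subsolutionLevels (Ω : Set (EuclideanSpace ℝ (Fin N)))
    (K : EuclideanSpace ℝ (Fin N) → EuclideanSpace ℝ (Fin N) → ℝ)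
    (a : EuclideanSpace ℝ (Fin N) → ℝ) : Set ℝ :=
  {l : ℝ | ∃ φ : EuclideanSpace ℝ (Fin N) → ℝ,
    ContinuousOn φ Ω ∧ MemLp φ ⊤ (volume.restrict Ω) ∧
    (∀ x ∈ Ω, 0 ≤ φ x) ∧ (∃ x ∈ Ω, φ x ≠ 0) ∧
    ∀ x ∈ Ω, 0 ≤ nonlocalOp Ω K φ x + (a x + l) * φ x}

/-- The real numbers `l` whose infimum is `λ_p''`: those for which `L_Ω + a + l` has a nontrivial
nonnegative continuous subsolution with compact support in `Ω`. -/
def compactSubsolutionLevels (Ω : Set (EuclideanSpace ℝ (Fin N)))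
    (K : EuclideanSpace ℝ (Fin N) → EuclideanSpace ℝ (Fin N) → ℝ)
    (a : EuclideanSpace ℝ (Fin N) → ℝ) : Set ℝ :=
  {l : ℝ | ∃ φ : EuclideanSpace ℝ (Fin N) → ℝ,
    Continuous φ ∧ HasCompactSupport φ ∧ tsupport φ ⊆ Ω ∧
    (∀ x ∈ Ω, 0 ≤ φ x) ∧ (∃ x ∈ Ω, φ x ≠ 0) ∧
    ∀ x ∈ Ω, 0 ≤ nonlocalOp Ω K φ x + (a x + l) * φ x}

theorem memLp_of_hasCompactSupport {φ : EuclideanSpace ℝ (Fin N) → ℝ} (hφ : Continuous φ)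
    (hc : HasCompactSupport φ) (p : ENNReal) : MemLp φ p (volume.restrict Ω) :=
  (hφ.memLp_of_hasCompactSupport hc).restrict Ω

theorem compactSubsolutionLevels_subset :
    compactSubsolutionLevels Ω K a ⊆ subsolutionLevels Ω K a := by
  rintro l ⟨φ, hφ, hc, -, h0, hne, h⟩
  exact ⟨φ, hφ.continuousOn, memLp_of_hasCompactSupport hφ hc ⊤, h0, hne, h⟩

theorem exists_abs_le_of_continuousOn_closure (hΩ_bdd : Bornology.IsBounded Ω)
    {f : EuclideanSpace ℝ (Fin N) → ℝ} (hf : ContinuousOn f (closure Ω)) :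
    ∃ B > 0, ∀ x ∈ closure Ω, |f x| ≤ B := by
  obtain ⟨B, hB⟩ := hΩ_bdd.isCompact_closure.exists_bound_of_continuousOn hf
  exact ⟨max B 1, lt_max_of_lt_right one_pos, fun x hx => (hB x hx).trans (le_max_left _ _)⟩

theorem exists_pos_le_of_continuousOn_closure (hΩ_bdd : Bornology.IsBounded Ω)
    {f : EuclideanSpace ℝ (Fin N) → ℝ} (hf : ContinuousOn f (closure Ω))
    (h : ∀ x ∈ closure Ω, 0 < f x) : ∃ m > 0, ∀ x ∈ closure Ω, m ≤ f x := by
  rcases (closure Ω).eq_empty_or_nonempty with he | hne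
  · exact ⟨1, one_pos, by simp [he]⟩
  · obtain ⟨x₀, hx₀, hmin⟩ := hΩ_bdd.isCompact_closure.exists_isMinOn hne hf
    exact ⟨f x₀, h x₀ hx₀, fun x hx => hmin hx⟩

theorem integrableOn_of_abs_le (hΩ : MeasurableSet Ω) (hΩ_bdd : Bornology.IsBounded Ω)
    {f : EuclideanSpace ℝ (Fin N) → ℝ} (hf : AEStronglyMeasurable f (volume.restrict Ω)) {B : ℝ}
    (hB : ∀ x ∈ Ω, |f x| ≤ B) : IntegrableOn f Ω :=
  have : IsFiniteMeasure (volume.restrict Ω) :=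
    isFiniteMeasure_restrict.2 hΩ_bdd.measure_lt_top.ne
  Integrable.of_bound hf B ((ae_restrict_mem hΩ).mono fun x hx => hB x hx)

theorem integrableOn_of_continuousOn_closure (hΩ_bdd : Bornology.IsBounded Ω)
    {f : EuclideanSpace ℝ (Fin N) → ℝ} (hf : ContinuousOn f (closure Ω)) : IntegrableOn f Ω :=
  (hf.integrableOn_compact hΩ_bdd.isCompact_closure).mono_set subset_closure

theorem exists_bound_of_continuousOn_of_memLp_top (hΩ_open : IsOpen Ω)
    {f : EuclideanSpace ℝ (Fin N) → ℝ} (hf : ContinuousOn f Ω)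
    (hf' : MemLp f ⊤ (volume.restrict Ω)) : ∃ B, ∀ x ∈ Ω, |f x| ≤ B := by
  obtain ⟨B, hB⟩ : ∃ B : ℝ, ∀ᵐ x ∂volume.restrict Ω, |f x| ≤ B := by
    refine ⟨(eLpNormEssSup f (volume.restrict Ω)).toReal, ?_⟩
    have hlt : eLpNormEssSup f (volume.restrict Ω) < ⊤ := by
      simpa [eLpNorm_exponent_top] using hf'.2
    filter_upwards [ae_le_eLpNormEssSup (f := f) (μ := volume.restrict Ω)] with x hx
    have := ENNReal.toReal_mono hlt.ne hx
    simpa using this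
  refine ⟨B, fun x hx => ?_⟩
  have heq : (fun x => max |f x| B) =ᵐ[volume.restrict Ω] fun _ => B :=
    hB.mono fun x hx => max_eq_right hx
  have := Measure.eqOn_open_of_ae_eq heq hΩ_open (hf.abs.sup continuousOn_const)
    continuousOn_const hx
  exact max_eq_right_iff.1 this

/-- Slide a multiple of the supersolution down onto the subsolution: at the smallest multiple
that still dominates, a gap `m < l` between the two levels leaves room to go further down. -/
theorem supersolution_le_subsolution (hΩ_open : IsOpen Ω) (hΩ_bdd : Bornology.IsBounded Ω)
    (ha : ContinuousOn a (closure Ω)) (hK : IsCaratheodoryKernel Ω K)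
    (hC : ∀ x ∈ Ω, ∀ y ∈ Ω, K x y ≤ C) {l m : ℝ} (hl : l ∈ supersolutionLevels Ω K a)
    (hm : m ∈ subsolutionLevels Ω K a) : l ≤ m := by
  obtain ⟨φ, hφc, hφ0, hφ⟩ := hl
  obtain ⟨ψ, hψc, hψb, hψ0, ⟨x₀, hx₀, hψx₀⟩, hψ⟩ := hm
  by_contra! hlt
  have hΩ := hΩ_open.measurableSet
  obtain ⟨M, hM⟩ := exists_bound_of_continuousOn_of_memLp_top hΩ_open hψc hψb
  obtain ⟨μ, hμ, hμφ⟩ := exists_pos_le_of_continuousOn_closure hΩ_bdd hφc hφ0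
  obtain ⟨B, hB, hBa⟩ := exists_abs_le_of_continuousOn_closure hΩ_bdd
    (f := fun x => a x + l) (ha.add continuousOn_const)
  have hφ0' : ∀ x ∈ Ω, 0 < φ x := fun x hx => hφ0 x (subset_closure hx)
  have hbdd : BddAbove ((fun x => ψ x / φ x) '' Ω) := by
    refine ⟨M / μ, ?_⟩
    rintro _ ⟨x, hx, rfl⟩
    have h1 := le_of_abs_le (hM x hx)
    exact div_le_div₀ ((hψ0 x hx).trans h1) h1 hμ (hμφ x (subset_closure hx))
  set t := sSup ((fun x => ψ x / φ x) '' Ω) with ht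
  have hle : ∀ x ∈ Ω, ψ x ≤ t * φ x := fun x hx =>
    (div_le_iff₀ (hφ0' x hx)).1 (le_csSup hbdd (mem_image_of_mem _ hx))
  have ht0 : 0 < t := by
    refine lt_of_lt_of_le ?_ (le_csSup hbdd (mem_image_of_mem _ hx₀))
    exact div_pos (lt_of_le_of_ne (hψ0 x₀ hx₀) hψx₀.symm) (hφ0' x₀ hx₀)
  have hφi := integrableOn_of_continuousOn_closure hΩ_bdd hφc
  have hψi := integrableOn_of_abs_le hΩ hΩ_bdd (hψc.aestronglyMeasurable hΩ) hM
  have hstep : ∀ x ∈ Ω, (B + (l - m)) * ψ x ≤ B * t * φ x := by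
    intro x hx
    have h1 := nonlocalOp_mono hΩ hK hC hψi (hφi.const_mul t) hle hx
    rw [nonlocalOp_const_mul] at h1
    have h2 := mul_le_mul_of_nonneg_left (hφ x hx) ht0.le
    have h3 := hψ x hx
    have h4 := neg_le_of_abs_le (hBa x (subset_closure hx))
    have h5 := mul_le_mul_of_nonneg_right h4 (sub_nonneg.2 (hle x hx))
    nlinarith
  have hpos : 0 < B + (l - m) := by linarith
  have hsup : t ≤ B * t / (B + (l - m)) := by
    refine csSup_le ((nonempty_of_mem hx₀).image _) ?_
    rintro _ ⟨x, hx, rfl⟩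
    simp only
    rw [div_le_div_iff₀ (hφ0' x hx) hpos]
    linarith [hstep x hx]
  rw [le_div_iff₀ hpos] at hsup
  nlinarith

/-- A supersolution at level `l'` keeps the increasing iteration
`u ↦ (1 + L_Ω[u]) / (-(a + l))` bounded for every `l < l'`; its limit solves the equation, and
it extends continuously to `closure Ω` because `L_Ω[u]` is uniformly continuous. -/
theorem exists_solution_of_lt (hΩ_open : IsOpen Ω) (hΩ_bdd : Bornology.IsBounded Ω)
    (ha : ContinuousOn a (closure Ω)) (hK : IsCaratheodoryKernel Ω K)
    (hC : ∀ x ∈ Ω, ∀ y ∈ Ω, K x y ≤ C) {l l' : ℝ} (hl' : l' ∈ supersolutionLevels Ω K a)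
    (hll' : l < l') :
    ∃ u : EuclideanSpace ℝ (Fin N) → ℝ, ContinuousOn u (closure Ω) ∧
      (∀ x ∈ closure Ω, 0 < u x) ∧ ∀ x ∈ Ω, nonlocalOp Ω K u x + (a x + l) * u x = -1 := by
  obtain ⟨φ, hφc, hφ0, hφ⟩ := hl'
  have hΩ := hΩ_open.measurableSet
  obtain ⟨μ, hμ, hμφ⟩ := exists_pos_le_of_continuousOn_closure hΩ_bdd hφc hφ0
  have hA : ∀ x ∈ closure Ω, 0 < -(a x + l) := by
    have : ∀ x ∈ closure Ω, a x ≤ -l' := by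
      intro x hx
      refine le_on_closure (fun y hy => ?_) ha continuousOn_const hx
      have h1 := nonlocalOp_nonneg hΩ hK (fun z hz => (hφ0 z (subset_closure hz)).le) hy
      have h2 : (a y + l') * φ y ≤ 0 := by linarith [hφ y hy]
      have h3 := nonpos_of_mul_nonpos_left h2 (hφ0 y (subset_closure hy))
      linarith
    intro x hx
    linarith [this x hx]
  have hAc : ContinuousOn (fun x => -(a x + l)) (closure Ω) := (ha.add continuousOn_const).neg
  -- a multiple of `φ` is an upper barrier for the iteration
  set Φ : EuclideanSpace ℝ (Fin N) → ℝ := fun x => ((l' - l) * μ)⁻¹ * φ x with hΦ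
  have hk : 0 < (l' - l) * μ := mul_pos (sub_pos.2 hll') hμ
  have hΦc : ContinuousOn Φ (closure Ω) := continuousOn_const.mul hφc
  have hΦi := integrableOn_of_continuousOn_closure hΩ_bdd hΦc
  have hΦ0 : ∀ x ∈ Ω, 0 ≤ Φ x := fun x hx =>
    mul_nonneg (inv_pos.2 hk).le (hφ0 x (subset_closure hx)).le
  have hΦs : ∀ x ∈ Ω, (1 + nonlocalOp Ω K Φ x) / -(a x + l) ≤ Φ x := by
    intro x hx
    rw [div_le_iff₀ (hA x (subset_closure hx)), hΦ, nonlocalOp_const_mul]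
    have h1 := mul_le_mul_of_nonneg_left (hμφ x (subset_closure hx)) (sub_pos.2 hll').le
    have h2 : nonlocalOp Ω K φ x ≤ -(a x + l) * φ x - (l' - l) * μ := by linarith [hφ x hx]
    have h3 := mul_le_mul_of_nonneg_left h2 (inv_pos.2 hk).le
    rw [mul_sub, inv_mul_cancel₀ hk.ne'] at h3
    linarith
  let u : ℕ → EuclideanSpace ℝ (Fin N) → ℝ := fun n =>
    Nat.rec (fun _ => 0) (fun _ v x => (1 + nonlocalOp Ω K v x) / -(a x + l)) n
  have hu_succ : ∀ n x, u (n + 1) x = (1 + nonlocalOp Ω K (u n) x) / -(a x + l) :=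
    fun n x => rfl
  obtain ⟨B, -, hB⟩ := exists_abs_le_of_continuousOn_closure hΩ_bdd hΦc
  have hint : ∀ v : EuclideanSpace ℝ (Fin N) → ℝ,
      AEStronglyMeasurable v (volume.restrict Ω) → (∀ x ∈ Ω, 0 ≤ v x) → (∀ x ∈ Ω, v x ≤ Φ x) →
      IntegrableOn v Ω := fun v hv h0 h1 =>
    integrableOn_of_abs_le hΩ hΩ_bdd hv fun x hx => by
      rw [abs_of_nonneg (h0 x hx)]
      exact (h1 x hx).trans (le_of_abs_le (hB x (subset_closure hx)))
  have hinv : ∀ n, IntegrableOn (u n) Ω ∧ (∀ x ∈ Ω, 0 ≤ u n x) ∧ ∀ x ∈ Ω, u n x ≤ Φ x := by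
    intro n
    induction n with
    | zero => exact ⟨integrableOn_zero, fun _ _ => le_rfl, hΦ0⟩
    | succ n ih =>
      obtain ⟨hi, h0, h1⟩ := ih
      have h0' : ∀ x ∈ Ω, 0 ≤ u (n + 1) x := fun x hx =>
        div_nonneg (add_nonneg zero_le_one (nonlocalOp_nonneg hΩ hK h0 hx))
          (hA x (subset_closure hx)).le
      have h1' : ∀ x ∈ Ω, u (n + 1) x ≤ Φ x := fun x hx =>
        (div_le_div_of_nonneg_right
          (add_le_add_right (nonlocalOp_mono hΩ hK hC hi hΦi h1 hx) 1)
          (hA x (subset_closure hx)).le).trans (hΦs x hx)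
      refine ⟨hint _ ?_ h0' h1', h0', h1'⟩
      refine ContinuousOn.aestronglyMeasurable ?_ hΩ
      exact (continuousOn_const.add (uniformContinuousOn_nonlocalOp hΩ hK hC hi).continuousOn).div
        (hAc.mono subset_closure) fun x hx => (hA x (subset_closure hx)).ne'
  have hmono : ∀ x ∈ Ω, Monotone fun n => u n x := by
    have : ∀ n, ∀ x ∈ Ω, u n x ≤ u (n + 1) x := by
      intro n
      induction n with
      | zero => exact fun x hx => (hinv 1).2.1 x hx
      | succ n ih =>
        exact fun x hx => div_le_div_of_nonneg_right
          (add_le_add_right (nonlocalOp_mono hΩ hK hC (hinv n).1 (hinv (n + 1)).1 ih hx) 1)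
          (hA x (subset_closure hx)).le
    exact fun x hx => monotone_nat_of_le_succ fun n => this n x hx
  set v : EuclideanSpace ℝ (Fin N) → ℝ := fun x => ⨆ n, u n x with hv
  have hlim : ∀ x ∈ Ω, Tendsto (fun n => u n x) atTop (𝓝 (v x)) := fun x hx =>
    tendsto_atTop_ciSup (hmono x hx)
      ⟨Φ x, by rintro _ ⟨n, rfl⟩; exact (hinv n).2.2 x hx⟩
  have hv0 : ∀ x ∈ Ω, 0 ≤ v x := fun x hx =>
    ge_of_tendsto' (hlim x hx) fun n => (hinv n).2.1 x hx
  have hv1 : ∀ x ∈ Ω, v x ≤ Φ x := fun x hx =>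
    le_of_tendsto' (hlim x hx) fun n => (hinv n).2.2 x hx
  have hvi : IntegrableOn v Ω := hint v
    (aestronglyMeasurable_of_tendsto_ae atTop (fun n => (hinv n).1.aestronglyMeasurable)
      ((ae_restrict_mem hΩ).mono hlim)) hv0 hv1
  have hLlim : ∀ x ∈ Ω,
      Tendsto (fun n => nonlocalOp Ω K (u n) x) atTop (𝓝 (nonlocalOp Ω K v x)) := by
    intro x hx
    refine tendsto_integral_of_dominated_convergence (fun y => K x y * Φ y)
      (fun n => (integrableOn_kernel_mul hΩ hK hC (hinv n).1 hx).aestronglyMeasurable)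
      (integrableOn_kernel_mul hΩ hK hC hΦi hx) (fun n => ?_) ?_
    · filter_upwards [ae_restrict_mem hΩ] with y hy
      have h1 := hK.nonneg x hx y hy
      rw [Real.norm_of_nonneg (mul_nonneg h1 ((hinv n).2.1 y hy))]
      exact mul_le_mul_of_nonneg_left ((hinv n).2.2 y hy) h1
    · filter_upwards [ae_restrict_mem hΩ] with y hy using (hlim y hy).const_mul _
  have hveq : ∀ x ∈ Ω, v x = (1 + nonlocalOp Ω K v x) / -(a x + l) := fun x hx =>
    tendsto_nhds_unique ((tendsto_add_atTop_iff_nat 1).2 (hlim x hx))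
      (((hLlim x hx).const_add 1).div_const _)
  obtain ⟨g, hgc, hg⟩ := exists_continuousOn_closure_of_uniformContinuousOn
    (uniformContinuousOn_nonlocalOp hΩ hK hC hvi)
  have hg0 : ∀ x ∈ closure Ω, 0 ≤ g x := fun x hx =>
    le_on_closure (f := fun _ => (0 : ℝ))
      (fun y hy => (nonlocalOp_nonneg hΩ hK hv0 hy).trans (hg hy).ge) continuousOn_const hgc hx
  have heq : EqOn (fun x => (1 + g x) / -(a x + l)) v Ω := fun x hx => by
    simp only [hg hx, hveq x hx]
  refine ⟨fun x => (1 + g x) / -(a x + l),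
    (continuousOn_const.add hgc).div hAc fun x hx => (hA x hx).ne',
    fun x hx => div_pos (by linarith [hg0 x hx]) (hA x hx), fun x hx => ?_⟩
  have hne := (hA x (subset_closure hx)).ne'
  rw [nonlocalOp_congr hΩ heq]
  simp only [hg hx]
  have hne' : a x + l ≠ 0 := fun h => hne (by rw [h, neg_zero])
  field_simp
  ring

theorem exists_cutoff {s U : Set (EuclideanSpace ℝ (Fin N))} (hs : IsCompact s) (hU : IsOpen U)
    (hsU : s ⊆ U) : ∃ χ : EuclideanSpace ℝ (Fin N) → ℝ, Continuous χ ∧ HasCompactSupport χ ∧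
      tsupport χ ⊆ U ∧ (∀ x ∈ s, χ x = 1) ∧ ∀ x, 0 ≤ χ x ∧ χ x ≤ 1 := by
  obtain ⟨k, hk, hsk, hkU⟩ := exists_compact_between hs hU hsU
  obtain ⟨f, hf1, hf0, hfc, hf⟩ := exists_continuous_one_zero_of_isCompact hs
    isOpen_interior.isClosed_compl (disjoint_compl_right_iff_subset.2 hsk)
  refine ⟨f, f.continuous, hfc, ?_, fun x hx => hf1 hx, fun x => hf x⟩
  refine (closure_minimal (fun x hx => ?_) hk.isClosed).trans hkU
  by_contra hxk
  exact hx (hf0 fun h => hxk (interior_subset h))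

theorem mem_compactSubsolutionLevels_of_neg_lt (hΩ_open : IsOpen Ω)
    (ha : ContinuousOn a Ω) (hK : IsCaratheodoryKernel Ω K) {x₀ : EuclideanSpace ℝ (Fin N)}
    (hx₀ : x₀ ∈ Ω) {m : ℝ} (hm : -a x₀ < m) : m ∈ compactSubsolutionLevels Ω K a := by
  have hU : IsOpen (Ω ∩ a ⁻¹' Ioi (-m)) := ha.isOpen_inter_preimage hΩ_open isOpen_Ioi
  obtain ⟨χ, hχ, hχc, hχs, hχ1, hχ01⟩ := exists_cutoff (isCompact_singleton (x := x₀)) hU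
    (singleton_subset_iff.2 ⟨hx₀, show -m < a x₀ by linarith⟩)
  refine ⟨χ, hχ, hχc, hχs.trans inter_subset_left, fun x _ => (hχ01 x).1,
    ⟨x₀, hx₀, by simp [hχ1 x₀ rfl]⟩, fun x hx => add_nonneg
      (nonlocalOp_nonneg hΩ_open.measurableSet hK (fun y _ => (hχ01 y).1) hx) ?_⟩
  by_cases h : x ∈ tsupport χ
  · have : -m < a x := (hχs h).2
    exact mul_nonneg (by linarith) (hχ01 x).1
  · rw [image_eq_zero_of_notMem_tsupport h, mul_zero]

/-- Cutting off a positive subsolution near the boundary changes `L_Ω[u]` uniformly little, which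
costs an arbitrarily small shift of the level. -/
theorem mem_compactSubsolutionLevels_of_pos (hΩ_open : IsOpen Ω) (hΩ_bdd : Bornology.IsBounded Ω)
    (hΩ_ne : Ω.Nonempty) (hK : IsCaratheodoryKernel Ω K)
    (hC0 : 0 < C) (hC : ∀ x ∈ Ω, ∀ y ∈ Ω, K x y ≤ C) {p θ : ℝ} (hθ : 0 < θ)
    (hpθ : ∀ x ∈ Ω, a x + (p + θ) ≤ 0) {u : EuclideanSpace ℝ (Fin N) → ℝ}
    (huc : ContinuousOn u (closure Ω)) (hu0 : ∀ x ∈ closure Ω, 0 < u x)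
    (hu : ∀ x ∈ Ω, 0 ≤ nonlocalOp Ω K u x + (a x + p) * u x) :
    p + θ ∈ compactSubsolutionLevels Ω K a := by
  have hΩ := hΩ_open.measurableSet
  have hvol := hΩ_bdd.measure_lt_top (μ := volume)
  obtain ⟨M, hM, hMu⟩ := exists_abs_le_of_continuousOn_closure hΩ_bdd huc
  obtain ⟨μ, hμ, hμu⟩ := exists_pos_le_of_continuousOn_closure hΩ_bdd huc hu0
  have hu0' : ∀ x ∈ Ω, 0 < u x := fun x hx => hu0 x (subset_closure hx)
  obtain ⟨x₀, hx₀⟩ := hΩ_ne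
  obtain ⟨s, hsΩ, hs, hsv⟩ := hΩ.exists_isCompact_sdiff_lt hvol.ne
    (ε := ENNReal.ofReal (θ * μ / (C * M))) (by simp; positivity)
  -- adjoining `x₀` makes the cutoff nontrivial
  obtain ⟨χ, hχ, hχc, hχs, hχ1, hχ01⟩ := exists_cutoff (hs.insert x₀) hΩ_open
    (insert_subset hx₀ hsΩ)
  have hψc : Continuous fun x => χ x * u x := by
    refine continuous_of_tsupport fun x hx => ?_
    have hxΩ : x ∈ Ω := hχs (tsupport_mul_subset_left hx)
    exact hχ.continuousAt.mul
      (huc.continuousAt (mem_of_superset (hΩ_open.mem_nhds hxΩ) subset_closure))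
  have hψs : tsupport (fun x => χ x * u x) ⊆ tsupport χ := tsupport_mul_subset_left
  have hψcs : HasCompactSupport fun x => χ x * u x := hχc.mul_right
  have hui := integrableOn_of_continuousOn_closure hΩ_bdd huc
  have hψi : IntegrableOn (fun x => χ x * u x) Ω :=
    (hψc.integrable_of_hasCompactSupport hψcs).integrableOn
  refine ⟨fun x => χ x * u x, hψc, hψcs, hψs.trans hχs,
    fun x hx => mul_nonneg (hχ01 x).1 (hu0' x hx).le,
    ⟨x₀, hx₀, by simp [hχ1 x₀ (mem_insert _ _), (hu0' x₀ hx₀).ne']⟩, fun x hx => ?_⟩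
  have hdiff : ∫ y in Ω, (u y - χ y * u y) ≤ M * (θ * μ / (C * M)) := by
    calc ∫ y in Ω, (u y - χ y * u y)
        ≤ ∫ y in Ω, (Ω \ s).indicator (fun _ => M) y := by
          refine setIntegral_mono_on (hui.sub hψi)
            ((integrableOn_const hvol.ne).indicator (hΩ.diff hs.measurableSet)) hΩ fun y hy => ?_
          by_cases hys : y ∈ s
          · rw [indicator_of_notMem (fun h => h.2 hys), hχ1 y (mem_insert_of_mem _ hys)]
            simp
          · rw [indicator_of_mem (show y ∈ Ω \ s from ⟨hy, hys⟩)]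
            have := mul_nonneg (hχ01 y).1 (hu0' y hy).le
            linarith [le_of_abs_le (hMu y (subset_closure hy))]
      _ = M * volume.real (Ω \ s) := by
          rw [setIntegral_indicator (hΩ.diff hs.measurableSet), setIntegral_const, smul_eq_mul,
            inter_eq_right.2 sdiff_subset, mul_comm]
      _ ≤ M * (θ * μ / (C * M)) := by
          gcongr
          exact ENNReal.toReal_le_of_le_ofReal (by positivity) hsv.le
  have h1 := nonlocalOp_sub hΩ hK hC hui hψi hx
  have h2 := nonlocalOp_le hΩ hK hC (hui.sub hψi) (fun y hy => by
    have h3 := mul_le_mul_of_nonneg_right (hχ01 y).2 (hu0' y hy).le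
    simp only [Pi.sub_apply]
    linarith) hx
  have h3 := mul_le_mul_of_nonneg_left hdiff hC0.le
  have h4 : C * (M * (θ * μ / (C * M))) = θ * μ := by field_simp
  have h5 := mul_le_mul_of_nonneg_left (hμu x (subset_closure hx)) hθ.le
  have h6 : 0 ≤ -(a x + (p + θ)) * ((1 - χ x) * u x) :=
    mul_nonneg (neg_nonneg.2 (hpθ x hx))
      (mul_nonneg (sub_nonneg.2 (hχ01 x).2) (hu0' x hx).le)
  have h7 : nonlocalOp Ω K (u - fun y => χ y * u y) x
      = nonlocalOp Ω K (fun y => u y - χ y * u y) x := rfl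
  have h8 : ∫ y in Ω, (u - fun y => χ y * u y) y = ∫ y in Ω, (u y - χ y * u y) := rfl
  have h9 := hu x hx
  rw [h7, h8] at h2
  nlinarith

/-! ### The common value of the three principal eigenvalues -/

/-- The heart of the argument. Just below the supremum `Λ` the solution of
`L_Ω[u] + (a + Λ - η) u = -1` has supremum at least of order `1 / η`, since otherwise `u` would be
a supersolution at level `Λ + η`. The Harnack inequality turns this into a lower bound of order
`1 / η` everywhere, so that the right hand side `-1` is only of order `η u`, and `u` is a
subsolution at a level within `O(η)` of `Λ`. -/
theorem exists_compactSubsolutionLevel_lt (hΩ_open : IsOpen Ω) (hΩ_conn : IsConnected Ω)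
    (hΩ_bdd : Bornology.IsBounded Ω) (ha : ContinuousOn a (closure Ω))
    (hK : IsCaratheodoryKernel Ω K) (hC0 : 0 < C) (hC : ∀ x ∈ Ω, ∀ y ∈ Ω, K x y ≤ C)
    {c₀ r : ℝ} (hc₀ : 0 < c₀) (hr : 0 < r)
    (hlow : ∀ x ∈ Ω, ∀ y ∈ Ω ∩ ball x r, c₀ ≤ K x y) {Λ : ℝ}
    (hΛ : IsLUB (supersolutionLevels Ω K a) Λ) {ε : ℝ} (hε : 0 < ε) :
    ∃ m ∈ compactSubsolutionLevels Ω K a, m < Λ + ε := by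
  have hΩ := hΩ_open.measurableSet
  by_cases hcase : ∃ x ∈ Ω, -a x < Λ + ε
  · obtain ⟨x, hx, hxε⟩ := hcase
    obtain ⟨m, hm1, hm2⟩ := exists_between hxε
    exact ⟨m, mem_compactSubsolutionLevels_of_neg_lt hΩ_open (ha.mono subset_closure) hK hx hm1,
      hm2⟩
  push Not at hcase
  -- from here on `a + Λ ≤ -ε` in `Ω`
  obtain ⟨B, hB, hBa⟩ := exists_abs_le_of_continuousOn_closure hΩ_bdd
    (f := fun x => a x + (Λ - 1)) (ha.add continuousOn_const)
  obtain ⟨c, hc, hharnack⟩ := exists_harnack_const hΩ_open hΩ_conn.isPreconnected hΩ_bdd hr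
    (div_pos hc₀ hB)
  -- `1 / (D η)` will be the lower bound for `u`: the mass estimate `ε ≤ 4 η C ∫ u` combined with
  -- the Harnack bound `c ∫ u ≤ u`
  set D := 4 * C / (c * ε) with hD
  have hD0 : 0 < D := by positivity
  obtain ⟨η, hη0, hη⟩ : ∃ η > 0, η ≤ 1 ∧ η ≤ ε / 4 ∧ D * η < ε := by
    refine ⟨min 1 (min (ε / 4) (ε / (2 * D))), by positivity, min_le_left _ _,
      (min_le_right _ _).trans (min_le_left _ _), ?_⟩
    calc D * min 1 (min (ε / 4) (ε / (2 * D))) ≤ D * (ε / (2 * D)) := by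
          gcongr
          exact (min_le_right _ _).trans (min_le_right _ _)
      _ = ε / 2 := by field_simp
      _ < ε := by linarith
  obtain ⟨hη1, hηε, hηD⟩ := hη
  obtain ⟨l', hl', hlt, -⟩ := hΛ.exists_between (show Λ - η < Λ by linarith)
  obtain ⟨u, huc, hu0, hu⟩ := exists_solution_of_lt hΩ_open hΩ_bdd ha hK hC hl' hlt
  have hu0' : ∀ x ∈ Ω, 0 < u x := fun x hx => hu0 x (subset_closure hx)
  have hui := integrableOn_of_continuousOn_closure hΩ_bdd huc
  obtain ⟨x₀, hx₀, hux₀⟩ : ∃ x ∈ Ω, 1 < 2 * η * u x := by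
    by_contra! h
    have hmem : Λ + η ∈ supersolutionLevels Ω K a := by
      refine ⟨u, huc, hu0, fun x hx => ?_⟩
      linarith [hu x hx, h x hx]
    linarith [hΛ.1 hmem]
  have hhar := hharnack u hui (fun x hx => (hu0' x hx).le) fun x hx => by
    rw [div_mul_eq_mul_div, div_le_iff₀' hB]
    calc c₀ * ∫ y in Ω ∩ ball x r, u y = ∫ y in Ω ∩ ball x r, c₀ * u y :=
          (integral_const_mul _ _).symm
      _ ≤ ∫ y in Ω ∩ ball x r, K x y * u y :=
          setIntegral_mono_on ((hui.mono_set inter_subset_left).const_mul _)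
            ((integrableOn_kernel_mul hΩ hK hC hui hx).mono_set inter_subset_left)
            (hΩ.inter measurableSet_ball)
            fun y hy => mul_le_mul_of_nonneg_right (hlow x hx y hy) (hu0' y hy.1).le
      _ ≤ nonlocalOp Ω K u x :=
          setIntegral_mono_set (integrableOn_kernel_mul hΩ hK hC hui hx)
            ((ae_restrict_mem hΩ).mono fun y hy =>
              mul_nonneg (hK.nonneg x hx y hy) (hu0' y hy).le)
            (Eventually.of_forall inter_subset_left)
      _ ≤ B * u x := by
          have h1 := neg_le_of_abs_le (hBa x (subset_closure hx))
          have h2 : -(a x + (Λ - η)) ≤ B := by linarith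
          have h3 := mul_le_mul_of_nonneg_right h2 (hu0' x hx).le
          linarith [hu x hx]
  set I := ∫ y in Ω, u y with hI
  have hIlow : ε ≤ 4 * η * (C * I) := by
    have h1 := nonlocalOp_le hΩ hK hC hui (fun y hy => (hu0' y hy).le) hx₀
    have h2 : ε ≤ -(a x₀ + (Λ - η)) := by linarith [hcase x₀ hx₀]
    have h3 := mul_le_mul_of_nonneg_right h2 (hu0' x₀ hx₀).le
    have h4 : ε * u x₀ ≤ 1 + C * I := by linarith [hu x₀ hx₀]
    have h5 := mul_le_mul_of_nonneg_left h4 (show 0 ≤ 4 * η by positivity)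
    have h6 := mul_le_mul_of_nonneg_left hux₀.le hε.le
    linarith
  have hulow : ∀ x ∈ Ω, 1 ≤ D * η * u x := by
    intro x hx
    calc (1 : ℝ) = ε / ε := (div_self hε.ne').symm
      _ ≤ 4 * η * (C * I) / ε := by gcongr
      _ = D * η * (c * I) := by rw [hD]; field_simp
      _ ≤ D * η * u x := by
          gcongr
          exact hhar x hx
  -- the shift `D η` absorbs the right hand side `-1`, the last `η` pays for the cutoff
  refine ⟨(Λ - η + D * η) + η, ?_, by linarith⟩
  refine mem_compactSubsolutionLevels_of_pos hΩ_open hΩ_bdd hΩ_conn.nonempty hK hC0 hC hη0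
    (fun x hx => by linarith [hcase x hx]) huc hu0 fun x hx => ?_
  linarith [hu x hx, hulow x hx]

theorem supersolutionLevels_nonempty (hΩ : MeasurableSet Ω) (hΩ_bdd : Bornology.IsBounded Ω)
    (ha : ContinuousOn a (closure Ω)) (hK : IsCaratheodoryKernel Ω K)
    (hC : ∀ x ∈ Ω, ∀ y ∈ Ω, K x y ≤ C) : (supersolutionLevels Ω K a).Nonempty := by
  obtain ⟨B, -, hB⟩ := exists_abs_le_of_continuousOn_closure hΩ_bdd ha
  refine ⟨-(B + C * ∫ _ in Ω, 1), fun _ => 1, continuousOn_const, fun _ _ => one_pos,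
    fun x hx => ?_⟩
  have h1 := nonlocalOp_le hΩ hK hC
    (integrableOn_of_continuousOn_closure hΩ_bdd (continuousOn_const (c := (1 : ℝ))))
    (fun _ _ => zero_le_one) hx
  linarith [le_of_abs_le (hB x (subset_closure hx))]

/-! ### The Rayleigh quotient -/

/-- A Carathéodory kernel is jointly measurable up to a null set. After discarding a null set of
`y`, every `K(x, ·)` is the limit of the `K(d, ·)` along a countable dense set of `d`, and
functions continuous in one variable and measurable in the other are jointly measurable. -/
theorem aestronglyMeasurable_uncurry_kernel (hΩ : MeasurableSet Ω) (hΩ_ne : Ω.Nonempty)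
    (hK : IsCaratheodoryKernel Ω K) :
    AEStronglyMeasurable (Function.uncurry K)
      ((volume.restrict Ω).prod (volume.restrict Ω)) := by
  have : Nonempty Ω := hΩ_ne.to_subtype
  let d : ℕ → Ω := TopologicalSpace.denseSeq Ω
  have hd : DenseRange d := TopologicalSpace.denseRange_denseSeq Ω
  let k : ℕ → EuclideanSpace ℝ (Fin N) → ℝ := fun n => (hK.measurable (d n) (d n).2).mk
  have hk : ∀ n, Measurable (k n) := fun n => (hK.measurable (d n) (d n).2).measurable_mk
  have hgood : ∀ᵐ y ∂volume.restrict Ω,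
      UniformContinuousOn (fun x => K x y) Ω ∧ ∀ n, K (d n) y = k n y :=
    hK.uniformContinuous.and (ae_all_iff.2 fun n => (hK.measurable (d n) (d n).2).ae_eq_mk)
  obtain ⟨t, hst, ht, ht0⟩ := exists_measurable_superset_of_null (ae_iff.1 hgood)
  have hG : ∀ y ∈ tᶜ, UniformContinuousOn (fun x => K x y) Ω ∧ ∀ n, K (d n) y = k n y :=
    fun y hy => not_not.1 fun h => hy (hst h)
  let K' : Ω → EuclideanSpace ℝ (Fin N) → ℝ := fun x => tᶜ.indicator (K x)
  have hK'c : ∀ y, Continuous fun x => K' x y := by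
    intro y
    by_cases hy : y ∈ tᶜ
    · have : (fun x : Ω => K' x y) = Ω.domRestrict fun x => K x y :=
        funext fun x => indicator_of_mem hy _
      rw [this]
      exact continuousOn_iff_continuous_domRestrict.1 (hG y hy).1.continuousOn
    · have : (fun x : Ω => K' x y) = fun _ => 0 := funext fun x => indicator_of_notMem hy _
      rw [this]
      exact continuous_const
  have hK'd : ∀ n, Measurable (K' (d n)) := by
    intro n
    have : K' (d n) = tᶜ.indicator (k n) := indicator_congr fun y hy => (hG y hy).2 n
    rw [this]
    exact (hk n).indicator ht.compl
  have hK'm : ∀ x, Measurable (K' x) := by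
    intro x
    obtain ⟨s, hs, hsx⟩ := mem_closure_iff_seq_limit.1 (hd x)
    refine measurable_of_tendsto_metrizable (f := fun n => K' (s n)) (fun n => ?_)
      (tendsto_pi_nhds.2 fun y => ((hK'c y).tendsto x).comp hsx)
    obtain ⟨m, hm⟩ := hs n
    rw [← hm]
    exact hK'd m
  classical
  let ρ : EuclideanSpace ℝ (Fin N) → Ω := fun x => if h : x ∈ Ω then ⟨x, h⟩ else d 0
  have hρ : Measurable ρ := Measurable.dite (s := Ω) measurable_id measurable_const hΩ
  have hjoint : Measurable fun p : EuclideanSpace ℝ (Fin N) × EuclideanSpace ℝ (Fin N) =>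
      K' (ρ p.1) p.2 :=
    (measurable_uncurry_of_continuous_of_measurable hK'c hK'm).comp
      ((hρ.comp measurable_fst).prodMk measurable_snd)
  refine ⟨_, hjoint.stronglyMeasurable, ?_⟩
  have h1 : ∀ᵐ p ∂(volume.restrict Ω).prod (volume.restrict Ω), p.1 ∈ Ω :=
    Measure.quasiMeasurePreserving_fst.ae (ae_restrict_mem hΩ)
  have h2 : ∀ᵐ p ∂(volume.restrict Ω).prod (volume.restrict Ω), p.2 ∈ tᶜ :=
    Measure.quasiMeasurePreserving_snd.ae (measure_eq_zero_iff_ae_notMem.1 ht0)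
  filter_upwards [h1, h2] with p hp1 hp2
  simp only [Function.uncurry, ρ, K', dif_pos hp1, indicator_of_mem hp2]

theorem integrableOn_quadraticForm (hΩ : MeasurableSet Ω) (hΩ_bdd : Bornology.IsBounded Ω)
    (ha : ContinuousOn a (closure Ω)) (hK : IsCaratheodoryKernel Ω K)
    (hC : ∀ x ∈ Ω, ∀ y ∈ Ω, K x y ≤ C) {ψ : EuclideanSpace ℝ (Fin N) → ℝ}
    (hψ : MemLp ψ 2 (volume.restrict Ω)) :
    IntegrableOn (fun x => nonlocalOp Ω K ψ x * ψ x) Ω ∧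
      IntegrableOn (fun x => a x * ψ x ^ 2) Ω := by
  have : IsFiniteMeasure (volume.restrict Ω) :=
    isFiniteMeasure_restrict.2 hΩ_bdd.measure_lt_top.ne
  have hψi : IntegrableOn ψ Ω := hψ.integrable one_le_two
  obtain ⟨B, -, hB⟩ := exists_abs_le_of_continuousOn_closure hΩ_bdd ha
  constructor
  · refine Integrable.bdd_mul (c := ∫ y in Ω, C * ‖ψ y‖) hψi
      ((uniformContinuousOn_nonlocalOp hΩ hK hC hψi).continuousOn.aestronglyMeasurable hΩ) ?_
    filter_upwards [ae_restrict_mem hΩ] with x hx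
    refine norm_integral_le_of_norm_le (hψi.norm.const_mul C) ?_
    filter_upwards [ae_restrict_mem hΩ] with y hy
    rw [norm_mul]
    exact mul_le_mul_of_nonneg_right (norm_kernel_le hK hC hx hy) (norm_nonneg _)
  · exact Integrable.bdd_mul (c := B) hψ.integrable_sq
      ((ha.mono subset_closure).aestronglyMeasurable hΩ)
      ((ae_restrict_mem hΩ).mono fun x hx => hB x (subset_closure hx))

/-- The form of a symmetric kernel is controlled by a supersolution `φ`: integrate
`2 ψ(x) ψ(y) ≤ ψ(x)² φ(y) / φ(x) + ψ(y)² φ(x) / φ(y)` against `K`. -/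
theorem quadraticForm_le_of_mem_supersolutionLevels (hΩ_open : IsOpen Ω) (hΩ_ne : Ω.Nonempty)
    (hΩ_bdd : Bornology.IsBounded Ω)
    (ha : ContinuousOn a (closure Ω)) (hK : IsCaratheodoryKernel Ω K)
    (hC : ∀ x ∈ Ω, ∀ y ∈ Ω, K x y ≤ C) (hsymm : ∀ x ∈ Ω, ∀ y ∈ Ω, K x y = K y x) {l : ℝ}
    (hl : l ∈ supersolutionLevels Ω K a) {ψ : EuclideanSpace ℝ (Fin N) → ℝ}
    (hψ : MemLp ψ 2 (volume.restrict Ω)) :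
    ∫ x in Ω, (nonlocalOp Ω K ψ x + a x * ψ x) * ψ x ≤ -l * ∫ x in Ω, ψ x ^ 2 := by
  obtain ⟨φ, hφc, hφ0, hφ⟩ := hl
  have hΩ := hΩ_open.measurableSet
  set ν := volume.restrict Ω with hν
  have : IsFiniteMeasure ν := isFiniteMeasure_restrict.2 hΩ_bdd.measure_lt_top.ne
  have hφ0' : ∀ x ∈ Ω, 0 < φ x := fun x hx => hφ0 x (subset_closure hx)
  have hψi : Integrable ψ ν := hψ.integrable one_le_two
  have hψ2 : Integrable (fun x => ψ x ^ 2) ν := hψ.integrable_sq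
  have hφi : Integrable φ ν := integrableOn_of_continuousOn_closure hΩ_bdd hφc
  obtain ⟨hLψ, haψ⟩ := integrableOn_quadraticForm hΩ hΩ_bdd ha hK hC hψ
  have hmem : ∀ᵐ p ∂ν.prod ν, p.1 ∈ Ω ∧ p.2 ∈ Ω :=
    (Measure.quasiMeasurePreserving_fst.ae (ae_restrict_mem hΩ)).and
      (Measure.quasiMeasurePreserving_snd.ae (ae_restrict_mem hΩ))
  have hKm := aestronglyMeasurable_uncurry_kernel hΩ hΩ_ne hK
  have hKb : ∀ᵐ p ∂ν.prod ν, ‖Function.uncurry K p‖ ≤ C :=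
    hmem.mono fun p hp => norm_kernel_le hK hC hp.1 hp.2
  have hinv : Integrable (fun x => (φ x)⁻¹ * ψ x ^ 2) ν := by
    obtain ⟨μ, hμ, hμφ⟩ := exists_pos_le_of_continuousOn_closure hΩ_bdd hφc hφ0
    refine Integrable.bdd_mul (c := μ⁻¹) hψ2 (((hφc.mono subset_closure).inv₀
      fun x hx => (hφ0' x hx).ne').aestronglyMeasurable hΩ) ?_
    filter_upwards [ae_restrict_mem hΩ] with x hx
    rw [Real.norm_of_nonneg (inv_pos.2 (hφ0' x hx)).le]
    exact inv_anti₀ hμ (hμφ x (subset_closure hx))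
  have hF : Integrable (fun p => Function.uncurry K p * (ψ p.1 * ψ p.2)) (ν.prod ν) :=
    (hψi.mul_prod hψi).bdd_mul hKm hKb
  have hG : Integrable (fun p => Function.uncurry K p * ((φ p.1)⁻¹ * ψ p.1 ^ 2 * φ p.2))
      (ν.prod ν) := (hinv.mul_prod hφi).bdd_mul hKm hKb
  have hFG : ∫ p, Function.uncurry K p * (ψ p.1 * ψ p.2) ∂ν.prod ν
      ≤ ∫ p, Function.uncurry K p * ((φ p.1)⁻¹ * ψ p.1 ^ 2 * φ p.2) ∂ν.prod ν := by
    set G : EuclideanSpace ℝ (Fin N) × EuclideanSpace ℝ (Fin N) → ℝ :=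
      fun p => Function.uncurry K p * ((φ p.1)⁻¹ * ψ p.1 ^ 2 * φ p.2) with hGdef
    have hle : ∫ p, Function.uncurry K p * (ψ p.1 * ψ p.2) ∂ν.prod ν
        ≤ ∫ p, (1 / 2) * (G p + G p.swap) ∂ν.prod ν := by
      refine integral_mono_ae hF ((hG.add hG.swap).const_mul _) ?_
      filter_upwards [hmem] with p hp
      have h1 := hφ0' p.1 hp.1
      have h2 := hφ0' p.2 hp.2
      have h3 := hK.nonneg p.1 hp.1 p.2 hp.2
      have h4 : (1 / 2) * (G p + G p.swap) - Function.uncurry K p * (ψ p.1 * ψ p.2)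
          = K p.1 p.2 * ((φ p.1 * φ p.2)⁻¹ * (ψ p.1 * φ p.2 - ψ p.2 * φ p.1) ^ 2) / 2 := by
        simp only [hGdef, Function.uncurry, Prod.fst_swap, Prod.snd_swap,
          hsymm p.2 hp.2 p.1 hp.1]
        field_simp
        ring
      have h5 : 0 ≤ K p.1 p.2 *
          ((φ p.1 * φ p.2)⁻¹ * (ψ p.1 * φ p.2 - ψ p.2 * φ p.1) ^ 2) / 2 := by positivity
      linarith
    have hswap : Integrable (fun p => G p.swap) (ν.prod ν) := hG.swap
    rw [integral_const_mul, integral_add hG hswap, integral_prod_swap G] at hle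
    linarith
  have hFeq : ∫ p, Function.uncurry K p * (ψ p.1 * ψ p.2) ∂ν.prod ν
      = ∫ x in Ω, nonlocalOp Ω K ψ x * ψ x := by
    rw [integral_prod _ hF]
    refine integral_congr_ae (Eventually.of_forall fun x => ?_)
    simp only [Function.uncurry, nonlocalOp]
    rw [← integral_mul_const]
    congr 1 with y
    ring
  have hGeq : ∫ p, Function.uncurry K p * ((φ p.1)⁻¹ * ψ p.1 ^ 2 * φ p.2) ∂ν.prod ν
      = ∫ x in Ω, nonlocalOp Ω K φ x * ((φ x)⁻¹ * ψ x ^ 2) := by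
    rw [integral_prod _ hG]
    refine integral_congr_ae (Eventually.of_forall fun x => ?_)
    simp only [Function.uncurry, nonlocalOp]
    rw [← integral_mul_const]
    congr 1 with y
    ring
  have hGi : Integrable (fun x => nonlocalOp Ω K φ x * ((φ x)⁻¹ * ψ x ^ 2)) ν := by
    refine hG.integral_prod_left.congr (Eventually.of_forall fun x => ?_)
    simp only [Function.uncurry, nonlocalOp]
    rw [← integral_mul_const]
    congr 1 with y
    ring
  have hlast : ∫ x in Ω, nonlocalOp Ω K φ x * ((φ x)⁻¹ * ψ x ^ 2)
      ≤ ∫ x in Ω, (-l * ψ x ^ 2 - a x * ψ x ^ 2) := by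
    refine setIntegral_mono_on hGi ((hψ2.const_mul _).sub haψ) hΩ fun x hx => ?_
    have h1 := hφ0' x hx
    have h2 : nonlocalOp Ω K φ x ≤ (-l - a x) * φ x := by linarith [hφ x hx]
    calc nonlocalOp Ω K φ x * ((φ x)⁻¹ * ψ x ^ 2)
        ≤ (-l - a x) * φ x * ((φ x)⁻¹ * ψ x ^ 2) := by gcongr
      _ = -l * ψ x ^ 2 - a x * ψ x ^ 2 := by field_simp
  rw [integral_sub (hψ2.const_mul _) haψ, integral_const_mul] at hlast
  have hsplit : ∫ x in Ω, (nonlocalOp Ω K ψ x + a x * ψ x) * ψ x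
      = (∫ x in Ω, nonlocalOp Ω K ψ x * ψ x) + ∫ x in Ω, a x * ψ x ^ 2 := by
    rw [← integral_add hLψ haψ]
    congr 1 with x
    ring
  rw [hsplit]
  linarith

theorem integral_sq_pos {ψ : EuclideanSpace ℝ (Fin N) → ℝ}
    (hψ : MemLp ψ 2 (volume.restrict Ω)) (hne : ¬ ψ =ᵐ[volume.restrict Ω] 0) :
    0 < ∫ x in Ω, ψ x ^ 2 := by
  refine lt_of_le_of_ne (integral_nonneg fun x => sq_nonneg _) fun h => hne ?_
  have := (integral_eq_zero_iff_of_nonneg (fun x => sq_nonneg (ψ x)) hψ.integrable_sq).1 h.symm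
  exact this.mono fun x hx => by simpa using hx

/-- A compactly supported subsolution is a test function for the Rayleigh quotient. -/
theorem exists_rayleigh_le (hΩ_open : IsOpen Ω)
    (hΩ_bdd : Bornology.IsBounded Ω) (ha : ContinuousOn a (closure Ω))
    (hK : IsCaratheodoryKernel Ω K) (hC : ∀ x ∈ Ω, ∀ y ∈ Ω, K x y ≤ C) {m : ℝ}
    (hm : m ∈ compactSubsolutionLevels Ω K a) :
    ∃ ψ : EuclideanSpace ℝ (Fin N) → ℝ, MemLp ψ 2 (volume.restrict Ω) ∧
      ¬ (ψ =ᵐ[volume.restrict Ω] 0) ∧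
      -((∫ x in Ω, (nonlocalOp Ω K ψ x + a x * ψ x) * ψ x) / ∫ x in Ω, ψ x ^ 2) ≤ m := by
  obtain ⟨ψ, hψc, hψs, -, hψ0, ⟨x₀, hx₀, hψx₀⟩, hψ⟩ := hm
  have hΩ := hΩ_open.measurableSet
  have hψL : MemLp ψ 2 (volume.restrict Ω) := memLp_of_hasCompactSupport hψc hψs 2
  have hne : ¬ (ψ =ᵐ[volume.restrict Ω] 0) := fun h => hψx₀
    (Measure.eqOn_open_of_ae_eq h hΩ_open hψc.continuousOn continuousOn_const hx₀)
  refine ⟨ψ, hψL, hne, ?_⟩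
  obtain ⟨hLψ, haψ⟩ := integrableOn_quadraticForm hΩ hΩ_bdd ha hK hC hψL
  rw [neg_le, le_div_iff₀ (integral_sq_pos hψL hne), ← integral_const_mul]
  refine setIntegral_mono_on (hψL.integrable_sq.const_mul _) ?_ hΩ fun x hx => ?_
  · refine (hLψ.add haψ).congr (Eventually.of_forall fun x => ?_)
    simp only [Pi.add_apply]
    ring
  · linarith [mul_nonneg (hψ x hx) (hψ0 x hx)]

/-! ### Extrema in the extended reals -/

theorem sSup_image_coe_eq_of_isLUB {S : Set ℝ} {Λ : ℝ} (h : IsLUB S Λ) :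
    sSup ((fun l : ℝ => (l : EReal)) '' S) = Λ := by
  refine le_antisymm (sSup_le ?_) (not_lt.1 fun hlt => ?_)
  · rintro _ ⟨l, hl, rfl⟩
    exact EReal.coe_le_coe_iff.2 (h.1 hl)
  · obtain ⟨q, hq1, hq2⟩ := EReal.lt_iff_exists_real_btwn.1 hlt
    obtain ⟨l, hl, hql, -⟩ := h.exists_between (EReal.coe_lt_coe_iff.1 hq2)
    exact (EReal.coe_lt_coe_iff.2 hql).not_ge
      ((le_sSup (mem_image_of_mem _ hl)).trans hq1.le)

theorem sInf_image_coe_eq {S : Set ℝ} {Λ : ℝ} (h : ∀ l ∈ S, Λ ≤ l)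
    (h' : ∀ ε > 0, ∃ l ∈ S, l < Λ + ε) : sInf ((fun l : ℝ => (l : EReal)) '' S) = Λ := by
  refine le_antisymm (not_lt.1 fun hlt => ?_) (le_sInf ?_)
  · obtain ⟨q, hq1, hq2⟩ := EReal.lt_iff_exists_real_btwn.1 hlt
    obtain ⟨l, hl, hlq⟩ := h' (q - Λ) (sub_pos.2 (EReal.coe_lt_coe_iff.1 hq1))
    rw [add_sub_cancel] at hlq
    exact (EReal.coe_lt_coe_iff.2 hlq).not_ge
      (hq2.le.trans (sInf_le (mem_image_of_mem _ hl)))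
  · rintro _ ⟨l, hl, rfl⟩
    exact EReal.coe_le_coe_iff.2 (h l hl)

end NonlocalEigenvalue

theorem theorem1 {N : ℕ} (Ω : Set (EuclideanSpace ℝ (Fin N)))
    (hΩ_open : IsOpen Ω) (hΩ_conn : IsConnected Ω) (hΩ_bdd : Bornology.IsBounded Ω)
    (K : EuclideanSpace ℝ (Fin N) → EuclideanSpace ℝ (Fin N) → ℝ)
    (a : EuclideanSpace ℝ (Fin N) → ℝ)
    (ha : NonlocalEigenvalue.IsPotential Ω a)
    (hK : NonlocalEigenvalue.IsCaratheodoryKernel Ω K)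
    (hK' : NonlocalEigenvalue.IsNondegenerate Ω K) :
    ∃ Λ : ℝ,
      NonlocalEigenvalue.lambdaP Ω K a = (Λ : EReal) ∧
      NonlocalEigenvalue.lambdaP' Ω K a = (Λ : EReal) ∧
      NonlocalEigenvalue.lambdaP'' Ω K a = (Λ : EReal) ∧
      ((∀ x ∈ Ω, ∀ y ∈ Ω, K x y = K y x) →
        NonlocalEigenvalue.lambdaV Ω K a = (Λ : EReal)) := by
  open NonlocalEigenvalue in
  obtain ⟨r₀, r₁, C, c₀, hr₁, -, hc₀, hcC, hbounds⟩ := hK'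
  have hC0 : 0 < C := hc₀.trans_le hcC
  have hC : ∀ x ∈ Ω, ∀ y ∈ Ω, K x y ≤ C := fun x hx y hy =>
    (hbounds x hx y hy).1.trans (mul_le_of_le_one_right hC0.le
      (Set.indicator_apply_le' (fun _ => le_rfl) fun _ => zero_le_one))
  have hlow : ∀ x ∈ Ω, ∀ y ∈ Ω ∩ Metric.ball x r₁, c₀ ≤ K x y := fun x hx y hy => by
    have := (hbounds x hx y hy.1).2
    rwa [Set.indicator_of_mem hy, mul_one] at this
  have hac := ha.continuousOn
  have hle : ∀ l ∈ supersolutionLevels Ω K a, ∀ m ∈ subsolutionLevels Ω K a, l ≤ m :=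
    fun l hl m hm => supersolution_le_subsolution hΩ_open hΩ_bdd hac hK hC hl hm
  obtain ⟨x₀, hx₀⟩ := hΩ_conn.nonempty
  have hsub : -a x₀ + 1 ∈ subsolutionLevels Ω K a := compactSubsolutionLevels_subset
    (mem_compactSubsolutionLevels_of_neg_lt hΩ_open (hac.mono subset_closure) hK hx₀
      (lt_add_one _))
  have hΛ : IsLUB (supersolutionLevels Ω K a) (sSup (supersolutionLevels Ω K a)) :=
    isLUB_csSup (supersolutionLevels_nonempty hΩ_open.measurableSet hΩ_bdd hac hK hC)
      ⟨_, fun l hl => hle l hl _ hsub⟩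
  set Λ := sSup (supersolutionLevels Ω K a)
  have hΛle : ∀ m ∈ subsolutionLevels Ω K a, Λ ≤ m := fun m hm => hΛ.2 fun l hl => hle l hl m hm
  have happrox : ∀ ε > 0, ∃ m ∈ compactSubsolutionLevels Ω K a, m < Λ + ε := fun ε hε =>
    exists_compactSubsolutionLevel_lt hΩ_open hΩ_conn hΩ_bdd hac hK hC0 hC hc₀ hr₁ hlow hΛ hε
  refine ⟨Λ, sSup_image_coe_eq_of_isLUB hΛ, sInf_image_coe_eq hΛle fun ε hε => ?_,
    sInf_image_coe_eq (fun m hm => hΛle m (compactSubsolutionLevels_subset hm)) happrox,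
    fun hsymm => sInf_image_coe_eq ?_ fun ε hε => ?_⟩
  · obtain ⟨m, hm, hmε⟩ := happrox ε hε
    exact ⟨m, compactSubsolutionLevels_subset hm, hmε⟩
  · rintro _ ⟨ψ, hψ, hne, rfl⟩
    refine hΛ.2 fun l hl => ?_
    rw [le_neg, div_le_iff₀ (integral_sq_pos hψ hne)]
    exact quadraticForm_le_of_mem_supersolutionLevels hΩ_open hΩ_conn.nonempty hΩ_bdd hac hK hC
      hsymm hl hψ
  · obtain ⟨m, hm, hmε⟩ := happrox ε hε
    obtain ⟨ψ, hψ, hne, hψm⟩ := exists_rayleigh_le hΩ_open hΩ_bdd hac hK hC hm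
    exact ⟨_, ⟨ψ, hψ, hne, rfl⟩, hψm.trans_lt hmε⟩
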